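/- Let $\mathscr{M}$ be the set of all isometry classes of non-empty compact metric spaces, equipped with the Gromov--Hausdorff distance. For a metric space $(X,d)$ write $B(x,r)$ for the closed ball with centre $x$ and radius $r$, and $\operatorname{diam} X$ for the diameter of $X$. The space $(X,d)$ is - *doubling* if there is $N\in\mathbb{N}$ such that for all $x\in X$ and $r>0$ there is a set $F\subseteq X$ with at most $N$ elements and $B(x,r)\subseteq\bigcup_{y\in F}B(y,r/2)$; - *uniformly disconnected* if there is $\delta>0$ such that $\delta\, d(z_1,z_N)\le\max_{1\le i\le N-1}d(z_i,z_{i+1})$ for every non-constant finite sequence $z_1,\dots,z_N$ in $X$; - *uniformly perfect* if there is $c\in(0,1)$ such that for all $x\in X$ and all $r\in(0,\operatorname{diam} X)$ there is $y\in X$ with $c\,r\le d(x,y)\le r$. Let $\mathscr{Q}_1,\mathscr{Q}_2,\mathscr{Q}_3\subseteq\mathscr{M}$ be the sets of all doubling, all uniformly disconnected, and all uniformly perfect spaces, respectively. For $k\in\{1,2,3\}$ put $\mathscr{E}_k(0)=\mathscr{M}\setminus\mathscr{Q}_k$, $\mathscr{E}_k(1)=\mathscr{Q}_k$ and $\mathscr{E}_k(2)=\mathscr{M}$,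 and for $(u,v,w)\in\{0,1,2\}^3$ put $$\mathscr{X}(u,v,w)=\mathscr{E}_1(u)\cap\mathscr{E}_2(v)\cap\mathscr{E}_3(w).$$ A subset of a topological space is $F_\sigma$ if it is a countable union of closed sets, $G_\delta$ if it is a countable intersection of open sets, $F_{\sigma\delta}$ if it is a countable intersection of $F_\sigma$ sets, and $G_{\delta\sigma}$ if it is a countable union of $G_\delta$ sets. **Theorem.** Let $(u,v,w)\in\{0,1,2\}^3$. Then the following hold. 1. If $\{u,v,w\}\setminus\{2\}=\{1\}$, then $\mathscr{X}(u,v,w)$ is a dense $F_\sigma$ subset of $\mathscr{M}$. 2. If $\{u,v,w\}\setminus\{2\}=\{0\}$, then $\mathscr{X}(u,v,w)$ is a dense $G_\delta$ subset of $\mathscr{M}$. 3. If $\{u,v,w\}\setminus\{2\}=\{0,1\}$, then $\mathscr{X}(u,v,w)$ is dense in $\mathscr{M}$, and it is both $F_{\sigma\delta}$ and $G_{\delta\sigma}$ in $\mathscr{M}$. -/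

import Mathlib

open GromovHausdorff

namespace GHTypes

/-- A metric space is `N`-doubling if every closed ball of radius `r > 0` is covered by at most
`N` closed balls of radius `r / 2`. -/
def IsDoublingWith (N : ℕ) (X : Type*) [MetricSpace X] : Prop :=
  ∀ x : X, ∀ r : ℝ, 0 < r → ∃ F : Finset X, F.card ≤ N ∧
    Metric.closedBall x r ⊆ ⋃ y ∈ F, Metric.closedBall y (r / 2)

/-- A metric space is doubling if it is `N`-doubling for some `N`. -/
def IsDoubling (X : Type*) [MetricSpace X] : Prop :=
  ∃ N : ℕ, IsDoublingWith N X

/-- A metric space is `δ`-uniformly disconnected if `δ * d(z₀, zₙ) ≤ maxᵢ d(zᵢ, zᵢ₊₁)` for every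
non-constant finite sequence `z₀, …, zₙ`. (Being non-constant forces `n ≥ 1`, so that the
supremum below is a maximum over a non-empty finite set.) -/
def IsUniformlyDisconnectedWith (δ : ℝ) (X : Type*) [MetricSpace X] : Prop :=
  ∀ (n : ℕ) (z : Fin (n + 1) → X), (¬ ∀ i j, z i = z j) →
    δ * dist (z 0) (z (Fin.last n)) ≤ ⨆ i : Fin n, dist (z i.castSucc) (z i.succ)

/-- A metric space is uniformly disconnected if it is `δ`-uniformly disconnected for some
`δ > 0`. -/
def IsUniformlyDisconnected (X : Type*) [MetricSpace X] : Prop :=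
  ∃ δ : ℝ, 0 < δ ∧ IsUniformlyDisconnectedWith δ X

/-- A metric space is `c`-uniformly perfect if for every point `x` and every `0 < r < diam X`
there is a point `y` with `c * r ≤ d(x, y) ≤ r`. -/
def IsUniformlyPerfectWith (c : ℝ) (X : Type*) [MetricSpace X] : Prop :=
  ∀ x : X, ∀ r : ℝ, 0 < r → ENNReal.ofReal r < Metric.ediam (Set.univ : Set X) →
    ∃ y : X, c * r ≤ dist x y ∧ dist x y ≤ r

/-- A metric space is uniformly perfect if it is `c`-uniformly perfect for some `0 < c < 1`. -/
def IsUniformlyPerfect (X : Type*) [MetricSpace X] : Prop :=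
  ∃ c : ℝ, 0 < c ∧ c < 1 ∧ IsUniformlyPerfectWith c X

/-- A set is `F_σ` if it is a countable union of closed sets. -/
def IsFsigma {X : Type*} [TopologicalSpace X] (s : Set X) : Prop :=
  ∃ f : ℕ → Set X, (∀ n, IsClosed (f n)) ∧ s = ⋃ n, f n

/-- A set is `F_{σδ}` if it is a countable intersection of `F_σ` sets. -/
def IsFsigmadelta {X : Type*} [TopologicalSpace X] (s : Set X) : Prop :=
  ∃ f : ℕ → Set X, (∀ n, IsFsigma (f n)) ∧ s = ⋂ n, f n

/-- A set is `G_{δσ}` if it is a countable union of `G_δ` sets. -/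
def IsGdeltasigma {X : Type*} [TopologicalSpace X] (s : Set X) : Prop :=
  ∃ f : ℕ → Set X, (∀ n, IsGδ (f n)) ∧ s = ⋃ n, f n

/-- The set of all doubling spaces in the Gromov–Hausdorff space. -/
def DO : Set GHSpace := {p | IsDoubling p.Rep}

/-- The set of all uniformly disconnected spaces in the Gromov–Hausdorff space. -/
def UD : Set GHSpace := {p | IsUniformlyDisconnected p.Rep}

/-- The set of all uniformly perfect spaces in the Gromov–Hausdorff space. -/
def UP : Set GHSpace := {p | IsUniformlyPerfect p.Rep}

/-- The subset prescribed by a code: `0` is the complement of `Q`, `1` is `Q`, and `2` imposes no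
condition. -/
def select (Q : Set GHSpace) (u : Fin 3) : Set GHSpace :=
  match u with
  | 0 => Qᶜ
  | 1 => Q
  | 2 => Set.univ

/-- The set of all compact metric spaces with the prescribed truth values `u`, `v`, `w` of the
doubling property, the uniform disconnectedness and the uniform perfectness. -/
def typeSet (u v w : Fin 3) : Set GHSpace :=
  select DO u ∩ select UD v ∩ select UP w

end GHTypes

namespace GHTypes

open Set Filter Topology Metric

/-! ### Approximate isometries between Gromov–Hausdorff close spaces -/

/-! Each property is a countable union, over its constant, of quantitative versions. Each version is
closed: nearby spaces are related by almost isometric, almost adjoint maps, and compactness removes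
the errors in the limit. So the three sets are `F_σ` and their complements `G_δ`. Every `typeSet` is
then an `F_σ` set intersected with a `G_δ` set, which is both `F_{σδ}` and `G_{δσ}` because closed
sets in a metric space are `G_δ`.

For density, replace a space by `F × K`, with `F` a finite net and `K` tiny and compact. The finite
factor affects none of the three properties, so `K` decides them. `exists_small_space` realises all
eight combinations independently: the branching of a tree controls doubling, an interval factor
destroys uniform disconnectedness, and an extra isolated point destroys uniform perfectness. -/

theorem exists_approx_maps {X Y : Type*} [MetricSpace X] [CompactSpace X] [Nonempty X]
    [MetricSpace Y] [CompactSpace Y] [Nonempty Y] {ε : ℝ} (h : ghDist X Y < ε) :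
    ∃ (f : X → Y) (g : Y → X), (∀ x x', |dist (f x) (f x') - dist x x'| ≤ 2 * ε) ∧
      ∀ x y, |dist (f x) y - dist x (g y)| ≤ 2 * ε := by
  obtain ⟨Φ, Ψ, hΦ, hΨ, hd⟩ := ghDist_eq_hausdorffDist X Y
  rw [hd] at h
  have fin : hausdorffEDist (range Φ) (range Ψ) ≠ ⊤ :=
    hausdorffEDist_ne_top_of_nonempty_of_bounded (range_nonempty _) (range_nonempty _)
      (isCompact_range hΦ.continuous).isBounded (isCompact_range hΨ.continuous).isBounded
  have hf : ∀ x, ∃ y, dist (Φ x) (Ψ y) < ε := fun x ↦ by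
    obtain ⟨_, ⟨y, rfl⟩, hy⟩ := exists_dist_lt_of_hausdorffDist_lt (mem_range_self x) h fin
    exact ⟨y, hy⟩
  have hg : ∀ y, ∃ x, dist (Φ x) (Ψ y) < ε := fun y ↦ by
    obtain ⟨_, ⟨x, rfl⟩, hx⟩ := exists_dist_lt_of_hausdorffDist_lt' (mem_range_self y) h fin
    exact ⟨x, hx⟩
  choose f hf using hf
  choose g hg using hg
  refine ⟨f, g, fun x x' ↦ ?_, fun x y ↦ ?_⟩
  · rw [← hΦ.dist_eq, ← hΨ.dist_eq, abs_sub_le_iff]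
    have h1 := dist_triangle4_left (Φ x) (Φ x') (Ψ (f x)) (Ψ (f x'))
    have h2 := dist_triangle4_right (Φ x) (Φ x') (Ψ (f x)) (Ψ (f x'))
    constructor <;> linarith [hf x, hf x']
  · rw [← hΦ.dist_eq, ← hΨ.dist_eq, abs_sub_le_iff]
    have h1 := dist_triangle4_left (Φ x) (Φ (g y)) (Ψ (f x)) (Ψ y)
    have h2 := dist_triangle4_right (Φ x) (Φ (g y)) (Ψ (f x)) (Ψ y)
    constructor <;> linarith [hf x, hg y]

theorem isClosed_of_approx_maps {Q : GHSpace → Prop}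
    (h : ∀ p : GHSpace, (∀ ε > 0, ∃ q, Q q ∧ ∃ (f : p.Rep → q.Rep) (g : q.Rep → p.Rep),
      (∀ x x', |dist (f x) (f x') - dist x x'| ≤ ε) ∧
        ∀ x y, |dist (f x) y - dist x (g y)| ≤ ε) → Q p) :
    IsClosed {p | Q p} := by
  refine isClosed_of_closure_subset fun p hp ↦ h p fun ε hε ↦ ?_
  obtain ⟨q, hq, hpq⟩ := Metric.mem_closure_iff.1 hp (ε / 2) (half_pos hε)
  rw [dist_ghDist] at hpq
  obtain ⟨f, g, hf, hg⟩ := exists_approx_maps hpq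
  rw [mul_div_cancel₀ _ two_ne_zero] at hf hg
  exact ⟨q, hq, f, g, hf, hg⟩

/-! ### Reformulations of the three properties -/

/-- Families of centres indexed by `Fin N` form a compact space when `X` is compact, which the
closedness proof needs. -/
theorem isDoublingWith_iff {N : ℕ} {X : Type*} [MetricSpace X] [Nonempty X] :
    IsDoublingWith N X ↔ ∀ x : X, ∀ r : ℝ, 0 < r → ∃ c : Fin N → X,
      ∀ z, dist z x ≤ r → ∃ i, dist z (c i) ≤ r / 2 := by
  classical
  refine forall_congr' fun x ↦ forall₂_congr fun r _ ↦ ⟨?_, ?_⟩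
  · rintro ⟨F, hF, hcov⟩
    refine ⟨fun i ↦ if h : i.1 < F.card then (F.equivFin.symm ⟨i, h⟩ : X) else x, fun z hz ↦ ?_⟩
    obtain ⟨y, hy, hzy⟩ := mem_iUnion₂.1 (hcov (mem_closedBall.2 hz))
    refine ⟨⟨F.equivFin ⟨y, hy⟩, (F.equivFin ⟨y, hy⟩).2.trans_le hF⟩, ?_⟩
    simpa using hzy
  · rintro ⟨c, hc⟩
    refine ⟨Finset.univ.image c, Finset.card_image_le.trans (by simp), fun z hz ↦ ?_⟩
    obtain ⟨i, hi⟩ := hc z hz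
    simp only [Finset.mem_image, Finset.mem_univ, true_and, mem_iUnion]
    exact ⟨c i, ⟨i, rfl⟩, hi⟩

theorem isDoubling_iff {X : Type*} [MetricSpace X] [Nonempty X] :
    IsDoubling X ↔ ∃ (ι : Type) (_ : Finite ι), ∀ x : X, ∀ r : ℝ, 0 < r → ∃ c : ι → X,
      ∀ z, dist z x ≤ r → ∃ i, dist z (c i) ≤ r / 2 := by
  constructor
  · rintro ⟨N, hN⟩
    exact ⟨Fin N, inferInstance, isDoublingWith_iff.1 hN⟩
  · rintro ⟨ι, _, h⟩
    obtain ⟨N, ⟨e⟩⟩ := Finite.exists_equiv_fin ι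
    refine ⟨N, isDoublingWith_iff.2 fun x r hr ↦ ?_⟩
    obtain ⟨c, hc⟩ := h x r hr
    refine ⟨c ∘ e.symm, fun z hz ↦ ?_⟩
    obtain ⟨i, hi⟩ := hc z hz
    exact ⟨e i, by simpa using hi⟩

/-- A free bound `M` can absorb errors, and constant chains need no exclusion since they only
require `0 ≤ M`. -/
theorem isUniformlyDisconnectedWith_iff {δ : ℝ} {X : Type*} [MetricSpace X] :
    IsUniformlyDisconnectedWith δ X ↔ ∀ (n : ℕ) (z : Fin (n + 1) → X) (M : ℝ), 0 ≤ M →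
      (∀ i : Fin n, dist (z i.castSucc) (z i.succ) ≤ M) →
        δ * dist (z 0) (z (Fin.last n)) ≤ M := by
  constructor
  · intro h n z M hM hz
    by_cases hc : ∀ i j, z i = z j
    · rw [hc 0 (Fin.last n), dist_self, mul_zero]
      exact hM
    · rcases n with _ | n
      · exact absurd (fun i j ↦ congrArg z (Fin.ext (by omega))) hc
      · exact (h _ z hc).trans (ciSup_le hz)
  · intro h n z _
    refine h n z _ (Real.iSup_nonneg fun _ ↦ dist_nonneg) fun i ↦ ?_
    exact le_ciSup (f := fun i : Fin n ↦ dist (z i.castSucc) (z i.succ)) (finite_range _).bddAbove i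

/-! ### Closedness -/

theorem isClosed_isDoublingWith (N : ℕ) : IsClosed {p : GHSpace | IsDoublingWith N p.Rep} := by
  refine isClosed_of_approx_maps fun p hp ↦ isDoublingWith_iff.2 fun x r hr ↦ ?_
  -- Centres that cover the ball up to error `1 / (n + 1)`. These sets are nested, compact and
  -- non-empty; a common point covers exactly, since finitely many strict failures would leave a
  -- uniform gap.
  let A : ℕ → Set (Fin N → p.Rep) := fun n ↦
    ⋂ z : {z : p.Rep // dist z x ≤ r}, ⋃ i, {c | dist z.1 (c i) ≤ r / 2 + 1 / (n + 1 : ℝ)}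
  have hAc : ∀ n, IsClosed (A n) := fun n ↦ isClosed_iInter fun z ↦ isClosed_iUnion_of_finite
    fun i ↦ isClosed_le (continuous_const.dist (continuous_apply i)) continuous_const
  have hAne : ∀ n, (A n).Nonempty := fun n ↦ by
    obtain ⟨q, hq, f, g, hf, hg⟩ := hp (1 / (2 * (n + 1))) (by positivity)
    have he : (1 : ℝ) / (2 * (n + 1)) = 1 / (n + 1) / 2 := by field_simp
    have hpos : (0 : ℝ) < 1 / (n + 1) := by positivity
    rw [he] at hf hg
    obtain ⟨c, hc⟩ := isDoublingWith_iff.1 hq (f x) (r + 1 / (n + 1) / 2) (by positivity)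
    refine ⟨fun i ↦ g (c i), mem_iInter.2 fun ⟨z, hz⟩ ↦ mem_iUnion.2 ?_⟩
    obtain ⟨i, hi⟩ := hc (f z) (by linarith [(abs_sub_le_iff.1 (hf z x)).1])
    refine ⟨i, ?_⟩
    change dist z (g (c i)) ≤ r / 2 + 1 / (n + 1)
    linarith [(abs_sub_le_iff.1 (hg z (c i))).2]
  have hAanti : ∀ n, A (n + 1) ⊆ A n := fun n ↦ iInter_mono fun z ↦ iUnion_mono fun i c hc ↦ by
    have hc : dist z.1 (c i) ≤ r / 2 + 1 / ((n + 1 : ℕ) + 1 : ℝ) := hc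
    refine hc.trans ?_
    push_cast
    gcongr
    linarith
  obtain ⟨c, hc⟩ := IsCompact.nonempty_iInter_of_sequence_nonempty_isCompact_isClosed A hAanti hAne
    (hAc 0).isCompact hAc
  refine ⟨c, fun z hz ↦ ?_⟩
  by_contra! hlt
  have hev : ∀ᶠ n : ℕ in atTop, ∀ i, r / 2 + 1 / (n + 1 : ℝ) < dist z (c i) := by
    refine eventually_all.2 fun i ↦ ?_
    have := (tendsto_one_div_add_atTop_nhds_zero_nat (𝕜 := ℝ)).const_add (r / 2)
    rw [add_zero] at this
    exact this.eventually (gt_mem_nhds (hlt i))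
  obtain ⟨n, hn⟩ := hev.exists
  obtain ⟨i, hi⟩ := mem_iUnion.1 (mem_iInter.1 (mem_iInter.1 hc n) ⟨z, hz⟩)
  exact (hn i).not_ge hi

theorem isClosed_isUniformlyDisconnectedWith {δ : ℝ} (hδ : 0 ≤ δ) :
    IsClosed {p : GHSpace | IsUniformlyDisconnectedWith δ p.Rep} := by
  refine isClosed_of_approx_maps fun p hp ↦ isUniformlyDisconnectedWith_iff.2 fun n z M hM hz ↦ ?_
  refine le_of_forall_pos_le_add fun η hη ↦ ?_
  have h1δ : 0 < 1 + δ := by positivity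
  -- The distortion enters once through the steps and `δ` times through the endpoints, hence the
  -- factor `1 + δ`.
  obtain ⟨q, hq, f, g, hf, -⟩ := hp (η / (1 + δ)) (by positivity)
  have h1 := isUniformlyDisconnectedWith_iff.1 hq n (f ∘ z) (M + η / (1 + δ)) (by positivity)
    fun i ↦ by
      have := (abs_sub_le_iff.1 (hf (z i.castSucc) (z i.succ))).1
      have := hz i
      simp only [Function.comp_apply]
      linarith
  have h2 := mul_le_mul_of_nonneg_left (abs_sub_le_iff.1 (hf (z 0) (z (Fin.last n)))).2 hδ
  have h3 : (1 + δ) * (η / (1 + δ)) = η := mul_div_cancel₀ _ h1δ.ne'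
  simp only [Function.comp_apply] at h1
  linarith

theorem isClosed_isUniformlyPerfectWith (c : ℝ) :
    IsClosed {p : GHSpace | IsUniformlyPerfectWith c p.Rep} := by
  refine isClosed_of_approx_maps fun p hp x r hr hdiam ↦ ?_
  obtain ⟨a, b, hab⟩ : ∃ a b : p.Rep, r < dist a b := by
    by_contra! h
    refine hdiam.not_ge (ediam_le fun a _ b _ ↦ ?_)
    rw [edist_dist]
    exact ENNReal.ofReal_le_ofReal (h a b)
  -- Minimise the violation of the two inequalities; it remains to make it smaller than every `ε`.
  obtain ⟨y, -, hy⟩ := (isCompact_univ (X := p.Rep)).exists_isMinOn univ_nonempty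
    (f := fun y ↦ max (c * r - dist x y) (dist x y - r)) (by fun_prop)
  suffices h : max (c * r - dist x y) (dist x y - r) ≤ 0 by
    rw [max_le_iff] at h
    exact ⟨y, by linarith, by linarith⟩
  refine le_of_forall_pos_le_add fun ε hε ↦ ?_
  -- The second bound keeps `dist (f a) (f b)` above `r`, so that `r` is still an admissible radius
  -- in `q`.
  obtain ⟨q, hq, f, g, hf, hg⟩ := hp (min ε ((dist a b - r) / 2))
    (lt_min hε (by linarith))
  obtain ⟨y', h1, h2⟩ := hq (f x) r hr (by
    refine lt_of_lt_of_le ?_ (edist_le_ediam_of_mem (mem_univ (f a)) (mem_univ (f b)))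
    rw [edist_dist, ENNReal.ofReal_lt_ofReal_iff_of_nonneg hr.le]
    have := (abs_sub_le_iff.1 (hf a b)).2
    have := min_le_right ε ((dist a b - r) / 2)
    linarith)
  refine (hy (mem_univ (g y'))).trans ?_
  have := abs_sub_le_iff.1 (hg x y')
  have := min_le_left ε ((dist a b - r) / 2)
  refine max_le ?_ ?_ <;> linarith

theorem IsUniformlyDisconnectedWith.mono {δ δ' : ℝ} {X : Type*} [MetricSpace X] (h : δ' ≤ δ)
    (hX : IsUniformlyDisconnectedWith δ X) : IsUniformlyDisconnectedWith δ' X :=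
  fun n z hz ↦ (mul_le_mul_of_nonneg_right h dist_nonneg).trans (hX n z hz)

theorem IsUniformlyPerfectWith.mono {c c' : ℝ} {X : Type*} [MetricSpace X] (h : c' ≤ c)
    (hX : IsUniformlyPerfectWith c X) : IsUniformlyPerfectWith c' X := fun x r hr hd ↦ by
  obtain ⟨y, h1, h2⟩ := hX x r hr hd
  exact ⟨y, (mul_le_mul_of_nonneg_right h hr.le).trans h1, h2⟩

theorem isFsigma_DO : IsFsigma DO :=
  ⟨_, isClosed_isDoublingWith, by ext; simp [DO, IsDoubling]⟩

theorem isFsigma_UD : IsFsigma UD := by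
  refine ⟨fun n : ℕ ↦ {p | IsUniformlyDisconnectedWith (1 / (n + 1)) p.Rep},
    fun n ↦ isClosed_isUniformlyDisconnectedWith (by positivity), ?_⟩
  ext p
  simp only [UD, mem_ofPred_eq, mem_iUnion]
  constructor
  · rintro ⟨δ, hδ, h⟩
    obtain ⟨n, hn⟩ := exists_nat_one_div_lt hδ
    exact ⟨n, h.mono hn.le⟩
  · rintro ⟨n, h⟩
    exact ⟨_, by positivity, h⟩

theorem isFsigma_UP : IsFsigma UP := by
  -- The extra `1` keeps the constant below `1` at `n = 0`.
  refine ⟨fun n : ℕ ↦ {p | IsUniformlyPerfectWith (1 / (n + 1 + 1)) p.Rep},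
    fun n ↦ isClosed_isUniformlyPerfectWith _, ?_⟩
  ext p
  simp only [UP, mem_ofPred_eq, mem_iUnion]
  constructor
  · rintro ⟨c, hc, -, h⟩
    obtain ⟨n, hn⟩ := exists_nat_one_div_lt hc
    refine ⟨n, h.mono (le_trans ?_ hn.le)⟩
    gcongr
    linarith
  · rintro ⟨n, h⟩
    refine ⟨_, by positivity, ?_, h⟩
    rw [div_lt_one (by positivity)]
    linarith [(Nat.cast_nonneg n : (0 : ℝ) ≤ n)]

/-! ### Countable unions and intersections -/

section Borel

variable {X : Type*} [TopologicalSpace X] {s t : Set X}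

theorem isFsigma_iff_isGδ_compl : IsFsigma s ↔ IsGδ sᶜ := by
  rw [isGδ_iff_eq_iInter_nat]
  constructor
  · rintro ⟨f, hf, rfl⟩
    exact ⟨fun n ↦ (f n)ᶜ, fun n ↦ (hf n).isOpen_compl, compl_iUnion _⟩
  · rintro ⟨f, hf, h⟩
    exact ⟨fun n ↦ (f n)ᶜ, fun n ↦ (hf n).isClosed_compl, by rw [← compl_iInter, ← h, compl_compl]⟩

theorem IsFsigma.inter (hs : IsFsigma s) (ht : IsFsigma t) : IsFsigma (s ∩ t) := by
  rw [isFsigma_iff_isGδ_compl] at *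
  rw [compl_inter]
  exact hs.union ht

theorem IsFsigma.inter_isGδ_isGdeltasigma [PerfectlyNormalSpace X] (hs : IsFsigma s)
    (ht : IsGδ t) : IsGdeltasigma (s ∩ t) := by
  obtain ⟨f, hf, rfl⟩ := hs
  exact ⟨fun n ↦ f n ∩ t, fun n ↦ (hf n).isGδ.inter ht, iUnion_inter _ _⟩

theorem IsFsigma.inter_isGδ_isFsigmadelta [PerfectlyNormalSpace X] (hs : IsFsigma s)
    (ht : IsGδ t) : IsFsigmadelta (s ∩ t) := by
  obtain ⟨f, hf, rfl⟩ := isGδ_iff_eq_iInter_nat.1 ht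
  refine ⟨fun n ↦ s ∩ f n, fun n ↦ hs.inter ?_, inter_iInter _ _⟩
  rw [isFsigma_iff_isGδ_compl]
  exact (hf n).isClosed_compl.isGδ

end Borel

end GHTypes

namespace GHTypes

open Set Filter Topology Metric

/-! ### Permanence properties -/

/-- Centres in `Y` may miss the image. Doubling twice gives balls of radius `r / 4`; recentring each
at an image point it contains costs a factor two. -/
theorem IsDoubling.of_isometry {X Y : Type*} [MetricSpace X] [MetricSpace Y] {f : X → Y}
    (hf : Isometry f) (hY : IsDoubling Y) : IsDoubling X := by
  classical
  rcases isEmpty_or_nonempty X with hX | hX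
  · exact ⟨0, fun x ↦ isEmptyElim x⟩
  have : Nonempty Y := hX.map f
  rw [isDoubling_iff] at hY ⊢
  obtain ⟨ι, _, h⟩ := hY
  refine ⟨ι × ι, inferInstance, fun x r hr ↦ ?_⟩
  obtain ⟨c, hc⟩ := h (f x) r hr
  choose d hd using fun i ↦ h (c i) (r / 2) (half_pos hr)
  refine ⟨fun i ↦ if hi : ∃ a, dist (f a) (d i.1 i.2) ≤ r / 2 / 2 then hi.choose else x,
    fun z hz ↦ ?_⟩
  obtain ⟨i, hi⟩ := hc (f z) (by rwa [hf.dist_eq])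
  obtain ⟨j, hj⟩ := hd i (f z) hi
  have hex : ∃ a, dist (f a) (d i j) ≤ r / 2 / 2 := ⟨z, hj⟩
  refine ⟨(i, j), ?_⟩
  simp only [dif_pos hex]
  rw [← hf.dist_eq]
  linarith [dist_triangle_right (f z) (f hex.choose) (d i j), hex.choose_spec]

theorem IsDoubling.prod {X Y : Type*} [MetricSpace X] [MetricSpace Y] [Nonempty X] [Nonempty Y]
    (hX : IsDoubling X) (hY : IsDoubling Y) : IsDoubling (X × Y) := by
  rw [isDoubling_iff] at *
  obtain ⟨ι, _, h⟩ := hX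
  obtain ⟨κ, _, h'⟩ := hY
  refine ⟨ι × κ, inferInstance, fun x r hr ↦ ?_⟩
  obtain ⟨c, hc⟩ := h x.1 r hr
  obtain ⟨d, hd⟩ := h' x.2 r hr
  refine ⟨fun i ↦ (c i.1, d i.2), fun z hz ↦ ?_⟩
  rw [Prod.dist_eq, max_le_iff] at hz
  obtain ⟨i, hi⟩ := hc _ hz.1
  obtain ⟨j, hj⟩ := hd _ hz.2
  exact ⟨(i, j), max_le hi hj⟩

theorem IsDoubling.of_finite {X : Type*} [MetricSpace X] [Finite X] : IsDoubling X := by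
  classical
  have := Fintype.ofFinite X
  refine ⟨Fintype.card X, fun x r hr ↦ ⟨Finset.univ, le_rfl, fun z _ ↦ ?_⟩⟩
  simp only [Finset.mem_univ, iUnion_true, mem_iUnion]
  exact ⟨z, mem_closedBall_self (half_pos hr).le⟩

theorem isDoubling_real : IsDoubling ℝ := by
  refine isDoubling_iff.2 ⟨Bool, inferInstance, fun x r _ ↦
    ⟨fun i ↦ if i then x + r / 2 else x - r / 2, fun z hz ↦ ?_⟩⟩
  rw [Real.dist_eq, abs_le] at hz
  rcases le_total z x with h | h
  · refine ⟨false, ?_⟩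
    rw [Real.dist_eq, abs_le]
    constructor <;> simp <;> linarith
  · refine ⟨true, ?_⟩
    rw [Real.dist_eq, abs_le]
    constructor <;> simp <;> linarith

theorem IsUniformlyDisconnected.of_isometry {X Y : Type*} [MetricSpace X] [MetricSpace Y]
    {f : X → Y} (hf : Isometry f) (hY : IsUniformlyDisconnected Y) :
    IsUniformlyDisconnected X := by
  obtain ⟨δ, hδ, h⟩ := hY
  refine ⟨δ, hδ, isUniformlyDisconnectedWith_iff.2 fun n z M hM hz ↦ ?_⟩
  rw [← hf.dist_eq]
  exact isUniformlyDisconnectedWith_iff.1 h n (f ∘ z) M hM fun i ↦ (hf.dist_eq _ _).trans_le (hz i)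

theorem IsUniformlyDisconnected.prod {X Y : Type*} [MetricSpace X] [MetricSpace Y]
    (hX : IsUniformlyDisconnected X) (hY : IsUniformlyDisconnected Y) :
    IsUniformlyDisconnected (X × Y) := by
  obtain ⟨δ, hδ, h⟩ := hX
  obtain ⟨δ', hδ', h'⟩ := hY
  have hmin := lt_min hδ hδ'
  refine ⟨min δ δ', hmin, isUniformlyDisconnectedWith_iff.2 fun n z M hM hz ↦ ?_⟩
  rw [Prod.dist_eq, mul_max_of_nonneg _ _ hmin.le]
  exact max_le
    (isUniformlyDisconnectedWith_iff.1 (h.mono (min_le_left _ _)) n (fun i ↦ (z i).1) M hM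
      fun i ↦ (le_max_left _ _).trans (hz i))
    (isUniformlyDisconnectedWith_iff.1 (h'.mono (min_le_right _ _)) n (fun i ↦ (z i).2) M hM
      fun i ↦ (le_max_right _ _).trans (hz i))

theorem IsUniformlyDisconnected.of_finite {X : Type*} [MetricSpace X] [Finite X] :
    IsUniformlyDisconnected X := by
  classical
  rcases isEmpty_or_nonempty X with hX | hX
  · exact ⟨1, one_pos, fun n z ↦ isEmptyElim (z 0)⟩
  -- The minimum is a separation constant; the value `1` on the diagonal keeps it positive. A chain
  -- with smaller steps is constant.
  obtain ⟨⟨x₀, y₀⟩, h₀⟩ := Finite.exists_min fun p : X × X ↦ if p.1 = p.2 then 1 else dist p.1 p.2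
  set s : ℝ := if x₀ = y₀ then 1 else dist x₀ y₀ with hs
  have hs0 : 0 < s := by
    rw [hs]
    split_ifs with h
    · exact one_pos
    · exact dist_pos.2 h
  have hsep : ∀ x y : X, dist x y < s → x = y := fun x y hxy ↦ by
    by_contra hne
    have := h₀ (x, y)
    simp only [if_neg hne] at this
    exact this.not_gt hxy
  have hD : 0 < diam (univ : Set X) + 1 := by positivity
  refine ⟨s / (diam (univ : Set X) + 1), by positivity,
    isUniformlyDisconnectedWith_iff.2 fun n z M hM hz ↦ ?_⟩
  rcases lt_or_ge M s with hMs | hMs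
  · have hconst : ∀ i, z i = z 0 := fun i ↦ by
      induction i using Fin.induction with
      | zero => rfl
      | succ i ih => rw [← ih, hsep _ _ ((hz i).trans_lt hMs)]
    rwa [hconst (Fin.last n), dist_self, mul_zero]
  · refine le_trans ?_ hMs
    rw [div_mul_eq_mul_div, div_le_iff₀ hD]
    have := dist_le_diam_of_mem (finite_univ (α := X)).isBounded (mem_univ (z 0))
      (mem_univ (z (Fin.last n)))
    gcongr
    linarith

theorem IsUniformlyPerfect.of_isometryEquiv {X Y : Type*} [MetricSpace X] [MetricSpace Y]
    (e : X ≃ᵢ Y) (hY : IsUniformlyPerfect Y) : IsUniformlyPerfect X := by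
  obtain ⟨c, hc, hc1, h⟩ := hY
  refine ⟨c, hc, hc1, fun x r hr hd ↦ ?_⟩
  obtain ⟨y, hy⟩ := h (e x) r hr (by rwa [← e.ediam_univ])
  refine ⟨e.symm y, ?_⟩
  rwa [← e.dist_eq, e.apply_symm_apply]

/-- For `r ≥ R`, the point found at scale `R / 2` still works after shrinking the constant, because
`r` is bounded by the diameter. -/
theorem isUniformlyPerfect_of_small_scales {X : Type*} [MetricSpace X] [BoundedSpace X] {c R : ℝ}
    (hc : 0 < c) (hR : 0 < R)
    (h : ∀ x : X, ∀ r, 0 < r → r < R → ∃ y, c * r ≤ dist x y ∧ dist x y ≤ r) :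
    IsUniformlyPerfect X := by
  set D := diam (univ : Set X) + 1
  have hD : 0 < D := by positivity
  refine ⟨min (1 / 2) (min c (c * (R / 2) / D)), by positivity,
    (min_le_left _ _).trans_lt (by norm_num), fun x r hr hdiam ↦ ?_⟩
  rcases lt_or_ge r R with hrR | hrR
  · obtain ⟨y, h1, h2⟩ := h x r hr hrR
    refine ⟨y, le_trans ?_ h1, h2⟩
    gcongr
    exact (min_le_right _ _).trans (min_le_left _ _)
  · obtain ⟨y, h1, h2⟩ := h x (R / 2) (half_pos hR) (half_lt_self hR)
    refine ⟨y, le_trans ?_ h1, by linarith⟩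
    have hrD : r ≤ D := by
      have hb : ediam (univ : Set X) ≠ ⊤ :=
        (isBounded_iff_ediam_ne_top (s := (univ : Set X))).1 (Bornology.isBounded_univ.2 ‹_›)
      have := (ENNReal.ofReal_lt_iff_lt_toReal hr.le hb).1 hdiam
      change r < diam univ at this
      linarith
    calc _ ≤ c * (R / 2) / D * D := by
          gcongr
          exact (min_le_right _ _).trans (min_le_right _ _)
      _ = c * (R / 2) := by field_simp

theorem not_isUniformlyPerfect_of_isOpen_singleton {X : Type*} [MetricSpace X] {x x' : X}
    (hx : IsOpen {x}) (hne : x ≠ x') : ¬ IsUniformlyPerfect X := by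
  rintro ⟨c, hc, -, h⟩
  obtain ⟨ρ, hρ, hiso⟩ := Metric.isOpen_singleton_iff.1 hx
  have hd := dist_pos.2 hne
  have hr : 0 < min (ρ / 2) (dist x x' / 2) := by positivity
  obtain ⟨y, h1, h2⟩ := h x _ hr (by
    refine lt_of_lt_of_le ?_ (edist_le_ediam_of_mem (mem_univ x) (mem_univ x'))
    rw [edist_dist, ENNReal.ofReal_lt_ofReal_iff hd]
    exact (min_le_right _ _).trans_lt (half_lt_self hd))
  have hy : y = x := hiso y (by
    rw [dist_comm]
    linarith [min_le_left (ρ / 2) (dist x x' / 2)])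
  rw [hy, dist_self] at h1
  nlinarith

/-- Equally spaced chains from `0` to `a` with `n + 1` steps force `δ ≤ 1 / (n + 1)`. -/
theorem not_isUniformlyDisconnected_of_isometry_Icc {X : Type*} [MetricSpace X] {a : ℝ}
    (ha : 0 < a) {f : Icc (0 : ℝ) a → X} (hf : Isometry f) : ¬ IsUniformlyDisconnected X := by
  intro hX
  obtain ⟨δ, hδ, h⟩ := hX.of_isometry hf
  obtain ⟨n, hn⟩ := exists_nat_one_div_lt hδ
  have hn0 : (0 : ℝ) < n + 1 := by positivity
  have := isUniformlyDisconnectedWith_iff.1 h (n + 1)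
    (fun i ↦ ⟨a * (i / (n + 1)), by positivity, by
      have hi : (i : ℝ) ≤ n + 1 := by exact_mod_cast Nat.le_of_lt_succ i.2
      exact mul_le_of_le_one_right ha.le ((div_le_one hn0).2 hi)⟩) (a / (n + 1)) (by positivity)
    (fun i ↦ by
      rw [Subtype.dist_eq, Real.dist_eq, abs_sub_comm]
      have : a * ((i.succ : ℕ) / (n + 1)) - a * ((i.castSucc : ℕ) / (n + 1)) = a / (n + 1) := by
        simp only [Fin.val_succ, Fin.val_castSucc]
        push_cast
        ring
      rw [this, abs_of_nonneg (by positivity)])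
  simp only [Subtype.dist_eq, Real.dist_eq, Fin.val_zero, Fin.val_last] at this
  push_cast at this
  rw [div_self hn0.ne', zero_div, mul_zero, mul_one, zero_sub, abs_neg, abs_of_pos ha,
    div_eq_mul_one_div, mul_comm a] at this
  exact (le_of_mul_le_mul_right this ha).not_gt hn

/-! ### Rooted trees with prescribed branching -/

/-- The space of infinite branches of the rooted tree in which every node at level `n` has `b n + 1`
children, with the distance `2 ^ (-n)` between branches that separate at level `n`. -/
def Tree (b : ℕ → ℕ) : Type := ∀ n, Fin (b n + 1)

namespace Tree

variable {b : ℕ → ℕ}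

noncomputable instance : MetricSpace (Tree b) := PiNat.metricSpace (E := fun n ↦ Fin (b n + 1))

instance : CompactSpace (Tree b) := inferInstanceAs (CompactSpace (∀ n, Fin (b n + 1)))

/-- The leftmost branch. -/
def root (b : ℕ → ℕ) : Tree b := fun _ ↦ 0

instance : Nonempty (Tree b) := ⟨root b⟩

theorem dist_le_pow_iff {x y : Tree b} {n : ℕ} : dist x y ≤ (1 / 2) ^ n ↔ ∀ i < n, x i = y i :=
  PiNat.mem_cylinder_iff_dist_le.symm

theorem pow_le_dist {x y : Tree b} {n : ℕ} (h : x n ≠ y n) : (1 / 2) ^ n ≤ dist x y := by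
  by_contra! hlt
  exact h (PiNat.apply_eq_of_dist_lt hlt le_rfl)

theorem dist_le_max (x y z : Tree b) : dist x z ≤ max (dist x y) (dist y z) :=
  PiNat.dist_triangle_nonarch x y z

theorem isUniformlyDisconnected : IsUniformlyDisconnected (Tree b) := by
  refine ⟨1, one_pos, isUniformlyDisconnectedWith_iff.2 fun n z M hM hz ↦ ?_⟩
  rw [one_mul]
  refine Fin.induction (motive := fun i ↦ dist (z 0) (z i) ≤ M) (by rwa [dist_self])
    (fun i ih ↦ ?_) (Fin.last n)
  exact (dist_le_max _ (z i.castSucc) _).trans (max_le ih (hz i))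

/-- The branch that agrees with `x` except possibly at level `n`. -/
def update (x : Tree b) (n : ℕ) (j : Fin (b n + 1)) : Tree b := Function.update x n j

theorem update_self (x : Tree b) (n : ℕ) (j : Fin (b n + 1)) : x.update n j n = j :=
  Function.update_self ..

theorem update_of_ne (x : Tree b) {n i : ℕ} (h : i ≠ n) (j : Fin (b n + 1)) :
    x.update n j i = x i :=
  Function.update_of_ne h ..

/-- If `n` is the first level with `2 ^ (-n) ≤ r`, branches in the ball agree with `x` below level
`n`. Fixing one of at most two values there leaves distance at most `r / 2`. -/
theorem isDoubling_of_le_one (hb : ∀ n, b n ≤ 1) : IsDoubling (Tree b) := by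
  refine isDoubling_iff.2 ⟨Fin 2, inferInstance, fun x r hr ↦ ?_⟩
  have hex : ∃ n : ℕ, (1 / 2 : ℝ) ^ n ≤ r :=
    (exists_pow_lt_of_lt_one hr (by norm_num)).imp fun _ h ↦ h.le
  classical
  set n := Nat.find hex
  have hn : (1 / 2 : ℝ) ^ n ≤ r := Nat.find_spec hex
  have hn' : ∀ k < n, r < (1 / 2 : ℝ) ^ k := fun k hk ↦ not_le.1 (Nat.find_min hex hk)
  refine ⟨fun i ↦ x.update n (Fin.ofNat _ i), fun z hz ↦ ⟨Fin.ofNat _ (z n), ?_⟩⟩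
  have : (1 / 2 : ℝ) ^ (n + 1) ≤ r / 2 := by
    rw [pow_succ]
    linarith
  refine le_trans (dist_le_pow_iff.2 fun i hi ↦ ?_) this
  rcases (Nat.lt_succ_iff.1 hi).eq_or_lt with rfl | hi
  · refine Eq.trans ?_ (update_self x n _).symm
    have h1 := (z n).2
    have h2 := hb n
    ext
    simp only [Fin.val_ofNat]
    rw [Nat.mod_eq_of_lt (b := 2) (by omega), Nat.mod_eq_of_lt h1]
  · refine Eq.trans ?_ (update_of_ne x hi.ne _).symm
    by_contra hne
    exact ((pow_le_dist hne).trans hz).not_gt (hn' i hi)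

/-- More than `N` children of one node at level `n` give branches in a ball of radius `2 ^ (-n)` at
mutual distance at least `2 ^ (-n)`. By the ultrametric inequality no ball of half the radius
contains two of them. -/
theorem not_isDoubling_of_unbounded (hb : ∀ N, ∃ n, N ≤ b n) : ¬ IsDoubling (Tree b) := by
  rintro ⟨N, hN⟩
  obtain ⟨n, hn⟩ := hb N
  obtain ⟨c, hc⟩ := isDoublingWith_iff.1 hN (root b) ((1 / 2) ^ n) (by positivity)
  have hball : ∀ j, dist ((root b).update n j) (root b) ≤ (1 / 2) ^ n := fun j ↦
    dist_le_pow_iff.2 fun i hi ↦ update_of_ne _ hi.ne _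
  choose k hk using fun j ↦ hc _ (hball j)
  obtain ⟨j, j', hne, heq⟩ := Fintype.exists_ne_map_eq_of_card_lt k (by simp; omega)
  have h1 : dist ((root b).update n j) ((root b).update n j') ≤ (1 / 2) ^ n / 2 :=
    (dist_le_max _ (c (k j)) _).trans (max_le (hk j) (by rw [dist_comm, heq]; exact hk j'))
  have h2 : (1 / 2 : ℝ) ^ n ≤ dist ((root b).update n j) ((root b).update n j') :=
    pow_le_dist (by rwa [update_self, update_self])
  have : (0 : ℝ) < (1 / 2) ^ n := by positivity
  linarith

theorem exists_dist_near {m : ℕ} (hb : ∀ n ≥ m, 1 ≤ b n) (x : Tree b) {r : ℝ} (hr : 0 < r)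
    (hrm : r < (1 / 2) ^ m) : ∃ y, 1 / 2 * r ≤ dist x y ∧ dist x y ≤ r := by
  -- With `2 ^ (-(n + 1)) < r ≤ 2 ^ (-n)`, switching child at level `n + 1` moves `x` by a distance
  -- between `r / 2` and `r`.
  obtain ⟨n, h1, h2⟩ := exists_nat_pow_near_of_lt_one hr
    (hrm.le.trans (pow_le_one₀ (by norm_num) (by norm_num))) (y := 1 / 2) (by norm_num)
    (by norm_num)
  have hm : m < n + 1 := (pow_lt_pow_iff_right_of_lt_one₀ (by norm_num) (by norm_num)).1
    (h1.trans hrm)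
  obtain ⟨j, hj⟩ : ∃ j, x (n + 1) ≠ j := by
    have := hb (n + 1) hm.le
    have : Nontrivial (Fin (b (n + 1) + 1)) := Fin.nontrivial_iff_two_le.2 (by omega)
    obtain ⟨j, hj⟩ := exists_ne (x (n + 1))
    exact ⟨j, hj.symm⟩
  refine ⟨x.update (n + 1) j, le_trans ?_ (pow_le_dist (n := n + 1) (by rwa [update_self])),
    le_trans (dist_le_pow_iff.2 fun i hi ↦ (update_of_ne x hi.ne j).symm) h1.le⟩
  rw [pow_succ]
  linarith

end Tree

end GHTypes

namespace GHTypes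

open Set Filter Topology Metric

/-! ### Small spaces with prescribed properties -/

theorem exists_small_space (U V W : Prop) {ε : ℝ} (hε : 0 < ε) :
    ∃ (K : Type) (_ : MetricSpace K) (_ : CompactSpace K) (k₀ : K), (∀ k, dist k k₀ ≤ ε) ∧
      (IsDoubling K ↔ U) ∧ (IsUniformlyDisconnected K ↔ V) ∧
      (W → ∃ c > 0, ∃ R > 0, ∀ x : K, ∀ r, 0 < r → r < R → ∃ y, c * r ≤ dist x y ∧ dist x y ≤ r) ∧
      (¬ W → ∃ x x' : K, IsOpen {x} ∧ x ≠ x') := by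
  classical
  obtain ⟨m, hm⟩ := exists_pow_lt_of_lt_one (half_pos hε) (show (1 / 2 : ℝ) < 1 by norm_num)
  set ρ : ℝ := (1 / 2) ^ m with hρdef
  have hρ : 0 < ρ := by positivity
  -- No branching below level `m` keeps the tree small; beyond it, binary branching is doubling and
  -- unbounded branching is not.
  let b : ℕ → ℕ := fun n ↦ if n < m then 0 else if U then 1 else n + 1
  have hb : ∀ n ≥ m, 1 ≤ b n := fun n hn ↦ by
    simp only [b, if_neg hn.not_gt]
    split_ifs <;> omega
  have hroot : ∀ x : Tree b, dist x (Tree.root b) ≤ ρ := fun x ↦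
    Tree.dist_le_pow_iff.2 fun i hi ↦ by
      have h1 : b i = 0 := if_pos hi
      have h2 := (x i).2
      have h3 := (Tree.root b i).2
      exact Fin.ext (by omega)
  let a : ℝ := if V then 0 else ρ
  have ha0 : 0 ≤ a := by simp only [a]; split_ifs <;> positivity
  have haρ : a ≤ ρ := by simp only [a]; split_ifs <;> linarith
  -- The extra point at height `2 * ρ` is isolated, as all other heights are at most `a ≤ ρ`.
  let S : Set (Tree b × ℝ) := {p | p.2 ∈ Icc 0 a} ∪ {p | ¬ W ∧ p = (Tree.root b, 2 * ρ)}
  have hSc : IsCompact S := by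
    have h1 : IsCompact {p : Tree b × ℝ | p.2 ∈ Icc 0 a} := by
      convert (isCompact_univ (X := Tree b)).prod (isCompact_Icc (a := (0 : ℝ)) (b := a)) using 1
      ext
      simp
    refine h1.union (Set.Finite.isCompact ((finite_singleton (Tree.root b, 2 * ρ)).subset ?_))
    exact fun p hp ↦ hp.2
  have hmem : ∀ z : Tree b, (z, (0 : ℝ)) ∈ S := fun z ↦ Or.inl ⟨le_rfl, ha0⟩
  have hS2 : ∀ p ∈ S, 0 ≤ p.2 ∧ p.2 ≤ 2 * ρ := by
    rintro p (⟨h0, h1⟩ | ⟨-, rfl⟩)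
    · exact ⟨h0, by linarith⟩
    · exact ⟨by positivity, le_rfl⟩
  have hval : Isometry (Subtype.val : S → Tree b × ℝ) := isometry_subtype_coe
  have htree : Isometry fun z : Tree b ↦ (⟨(z, 0), hmem z⟩ : S) := Isometry.of_dist_eq fun z z' ↦ by
    rw [Subtype.dist_eq, Prod.dist_eq, dist_self]
    exact max_eq_left dist_nonneg
  refine ⟨S, inferInstance, isCompact_iff_compactSpace.1 hSc, ⟨(Tree.root b, 0), hmem _⟩,
    fun k ↦ ?_, ⟨fun h ↦ ?_, fun h ↦ ?_⟩, ⟨fun h ↦ ?_, fun h ↦ ?_⟩, fun h ↦ ?_, fun h ↦ ?_⟩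
  · have := hS2 k k.2
    refine max_le ((hroot _).trans (by linarith)) ?_
    rw [Real.dist_eq, sub_zero, abs_of_nonneg this.1]
    linarith
  · by_contra hU
    refine Tree.not_isDoubling_of_unbounded (fun N ↦ ⟨max N m, ?_⟩) (h.of_isometry htree)
    simp only [b, if_neg (le_max_right N m).not_gt, if_neg hU]
    omega
  · refine IsDoubling.of_isometry hval (IsDoubling.prod ?_ isDoubling_real)
    refine Tree.isDoubling_of_le_one fun n ↦ ?_
    simp only [b, if_pos h]
    split_ifs <;> omega
  · by_contra hV
    have haρ' : a = ρ := if_neg hV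
    refine not_isUniformlyDisconnected_of_isometry_Icc (a := a) (haρ' ▸ hρ)
      (f := fun t ↦ (⟨(Tree.root b, t), Or.inl t.2⟩ : S)) (Isometry.of_dist_eq fun t t' ↦ ?_) h
    rw [Subtype.dist_eq, Prod.dist_eq, dist_self]
    exact max_eq_right dist_nonneg
  -- Only the heights `0` and `2 * ρ` occur, so `S` embeds in the product of the tree with a finite
  -- space.
  · have ha : a = 0 := if_pos h
    have hp : ∀ p : S, p.1.2 ∈ ({0, 2 * ρ} : Set ℝ) := by
      rintro ⟨p, ⟨h0, h1⟩ | ⟨-, rfl⟩⟩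
      · exact Or.inl (le_antisymm (h1.trans_eq ha) h0)
      · exact Or.inr rfl
    have hfin : Finite ({0, 2 * ρ} : Set ℝ) := inferInstance
    refine IsUniformlyDisconnected.of_isometry
      (f := fun p : S ↦ (p.1.1, (⟨p.1.2, hp p⟩ : ({0, 2 * ρ} : Set ℝ))))
      (Isometry.of_dist_eq fun p q ↦ rfl)
      (Tree.isUniformlyDisconnected.prod .of_finite)
  · refine ⟨1 / 2, by norm_num, ρ, hρ, ?_⟩
    rintro ⟨⟨z, t⟩, hx⟩ r hr hrρ
    have ht : t ∈ Icc 0 a := hx.resolve_right fun h' ↦ h'.1 h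
    obtain ⟨y, hy⟩ := Tree.exists_dist_near hb z hr hrρ
    refine ⟨⟨(y, t), Or.inl ht⟩, ?_⟩
    rw [Subtype.dist_eq, Prod.dist_eq, dist_self, max_eq_left dist_nonneg]
    exact hy
  · refine ⟨⟨(Tree.root b, 2 * ρ), Or.inr ⟨h, rfl⟩⟩, ⟨(Tree.root b, 0), hmem _⟩, ?_, ?_⟩
    · refine Metric.isOpen_singleton_iff.2 ⟨ρ, hρ, ?_⟩
      rintro ⟨p, ⟨h0, h1⟩ | ⟨-, rfl⟩⟩ hd
      · have := (le_max_right _ _).trans_lt hd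
        rw [Real.dist_eq, abs_lt] at this
        simp only at this
        linarith
      · rfl
    · intro heq
      have : 2 * ρ = 0 := congrArg (fun p : S ↦ p.1.2) heq
      linarith

/-! ### Density -/

theorem exists_near_of_props (p : GHSpace) {ε : ℝ} (hε : 0 < ε) (U V W : Prop) :
    ∃ q, dist p q < ε ∧ (q ∈ DO ↔ U) ∧ (q ∈ UD ↔ V) ∧ (q ∈ UP ↔ W) := by
  obtain ⟨F, -, hF, hcov⟩ := finite_cover_balls_of_compact (isCompact_univ (X := p.Rep))
    (show 0 < ε / 4 by positivity)
  have hnet : ∀ x : p.Rep, ∃ y ∈ F, dist x y ≤ ε / 4 := fun x ↦ by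
    obtain ⟨y, hy, hxy⟩ := mem_iUnion₂.1 (hcov (mem_univ x))
    exact ⟨y, hy, (mem_ball.1 hxy).le⟩
  have : Finite F := hF
  have hFne : Nonempty F := by
    obtain ⟨y, hy, -⟩ := hnet (Classical.arbitrary _)
    exact ⟨⟨y, hy⟩⟩
  obtain ⟨f₀⟩ := id hFne
  obtain ⟨K, _, _, k₀, hk, hU, hV, hW, hW'⟩ :=
    exists_small_space U V W (show 0 < ε / 4 by positivity)
  have hKne : Nonempty K := ⟨k₀⟩
  obtain ⟨e⟩ := toGHSpace_eq_toGHSpace_iff_isometryEquiv.1 (toGHSpace (F × K)).toGHSpace_rep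
  have hK : Isometry fun k : K ↦ (f₀, k) := Isometry.of_dist_eq fun k k' ↦ by
    rw [Prod.dist_eq, dist_self]
    exact max_eq_right dist_nonneg
  refine ⟨toGHSpace (F × K), ?_, ?_, ?_, ?_⟩
  -- The slice `F × {k₀}` is an isometric copy of the net (`ε₂ = 0`) and `ε / 4`-dense in `F × K`;
  -- the total is `ε / 2`.
  · have h := ghDist_le_of_approx_subsets (X := p.Rep) (Y := F × K) (s := F) (ε₁ := ε / 4)
      (ε₂ := 0) (ε₃ := ε / 4) (fun f ↦ (f, k₀)) hnet
      (fun x ↦ ⟨x.1, max_le (by rw [dist_self]; positivity) (hk _)⟩) (fun x y ↦ by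
        rw [Prod.dist_eq, dist_self, max_eq_left dist_nonneg, Subtype.dist_eq, sub_self, abs_zero])
    rw [ghDist, p.toGHSpace_rep] at h
    linarith
  · rw [← hU]
    exact ⟨fun h ↦ (IsDoubling.of_isometry e.symm.isometry h).of_isometry hK,
      fun h ↦ (IsDoubling.prod .of_finite h).of_isometry e.isometry⟩
  · rw [← hV]
    exact ⟨fun h ↦ (IsUniformlyDisconnected.of_isometry e.symm.isometry h).of_isometry hK,
      fun h ↦ (IsUniformlyDisconnected.prod .of_finite h).of_isometry e.isometry⟩
  · constructor
    · intro h
      by_contra hnW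
      obtain ⟨x, x', hx, hne⟩ := hW' hnW
      refine not_isUniformlyPerfect_of_isOpen_singleton (x := (f₀, x)) (x' := (f₀, x')) ?_
        (fun h ↦ hne (congrArg Prod.snd h)) (IsUniformlyPerfect.of_isometryEquiv e.symm h)
      rw [← singleton_prod_singleton]
      exact (isOpen_discrete _).prod hx
    · intro h
      obtain ⟨c, hc, R, hR, hcR⟩ := hW h
      refine IsUniformlyPerfect.of_isometryEquiv e
        (isUniformlyPerfect_of_small_scales hc hR fun x r hr hrR ↦ ?_)
      obtain ⟨y, hy⟩ := hcR x.2 r hr hrR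
      refine ⟨(x.1, y), ?_⟩
      rwa [Prod.dist_eq, dist_self, max_eq_right dist_nonneg]

theorem mem_select_of_iff {Q : Set GHSpace} {u : Fin 3} {q : GHSpace} (h : q ∈ Q ↔ u = 1) :
    q ∈ select Q u := by
  fin_cases u <;> simp_all [select]

theorem dense_typeSet (u v w : Fin 3) : Dense (typeSet u v w) := by
  refine Metric.dense_iff.2 fun p ε hε ↦ ?_
  -- For code `2` this asks for failure of the property, which is harmless.
  obtain ⟨q, hd, hU, hV, hW⟩ := exists_near_of_props p hε (u = 1) (v = 1) (w = 1)
  exact ⟨q, by rwa [mem_ball'], ⟨mem_select_of_iff hU, mem_select_of_iff hV⟩, mem_select_of_iff hW⟩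

/-! ### Borel complexity -/

theorem IsFsigma.select {Q : Set GHSpace} (hQ : IsFsigma Q) {u : Fin 3} (hu : u ≠ 0) :
    IsFsigma (select Q u) := by
  fin_cases u
  · exact absurd rfl hu
  · exact hQ
  · exact isFsigma_iff_isGδ_compl.2 (by simp [GHTypes.select])

theorem IsFsigma.isGδ_select {Q : Set GHSpace} (hQ : IsFsigma Q) {u : Fin 3} (hu : u ≠ 1) :
    IsGδ (GHTypes.select Q u) := by
  fin_cases u
  · exact isFsigma_iff_isGδ_compl.1 hQ
  · exact absurd rfl hu
  · exact IsGδ.univ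

theorem isFsigma_typeSet {u v w : Fin 3} (hu : u ≠ 0) (hv : v ≠ 0) (hw : w ≠ 0) :
    IsFsigma (typeSet u v w) :=
  ((isFsigma_DO.select hu).inter (isFsigma_UD.select hv)).inter (isFsigma_UP.select hw)

theorem isGδ_typeSet {u v w : Fin 3} (hu : u ≠ 1) (hv : v ≠ 1) (hw : w ≠ 1) :
    IsGδ (typeSet u v w) :=
  ((isFsigma_DO.isGδ_select hu).inter (isFsigma_UD.isGδ_select hv)).inter
    (isFsigma_UP.isGδ_select hw)

/-- The first factor retains only a positive condition (`F_σ`), the second only a negative one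
(`G_δ`). -/
theorem select_eq_inter (Q : Set GHSpace) (u : Fin 3) :
    select Q u = select Q (if u = 0 then 2 else u) ∩ select Q (if u = 1 then 2 else u) := by
  fin_cases u <;> simp [select]

theorem exists_typeSet_eq_inter (u v w : Fin 3) :
    ∃ s t, IsFsigma s ∧ IsGδ t ∧ typeSet u v w = s ∩ t := by
  have h : ∀ i : Fin 3, (if i = 0 then 2 else i) ≠ 0 := by decide
  have h' : ∀ i : Fin 3, (if i = 1 then 2 else i) ≠ 1 := by decide
  refine ⟨_, _, isFsigma_typeSet (u := if u = 0 then 2 else u) (v := if v = 0 then 2 else v)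
    (w := if w = 0 then 2 else w) (h _) (h _) (h _), isGδ_typeSet (u := if u = 1 then 2 else u)
    (v := if v = 1 then 2 else v) (w := if w = 1 then 2 else w) (h' _) (h' _) (h' _), ?_⟩
  rw [typeSet, select_eq_inter DO u, select_eq_inter UD v, select_eq_inter UP w]
  ext
  simp only [typeSet, mem_inter_iff]
  tauto

end GHTypes

theorem mainTheorem2 (u v w : Fin 3) :
    (({u, v, w} : Set (Fin 3)) \ {2} = {1} →
      Dense (GHTypes.typeSet u v w) ∧ GHTypes.IsFsigma (GHTypes.typeSet u v w)) ∧
    (({u, v, w} : Set (Fin 3)) \ {2} = {0} →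
      Dense (GHTypes.typeSet u v w) ∧ IsGδ (GHTypes.typeSet u v w)) ∧
    (({u, v, w} : Set (Fin 3)) \ {2} = {0, 1} →
      Dense (GHTypes.typeSet u v w) ∧ GHTypes.IsFsigmadelta (GHTypes.typeSet u v w) ∧
        GHTypes.IsGdeltasigma (GHTypes.typeSet u v w)) := by
  have hdense := GHTypes.dense_typeSet u v w
  refine ⟨fun h ↦ ⟨hdense, ?_⟩, fun h ↦ ⟨hdense, ?_⟩, fun _ ↦ ⟨hdense, ?_⟩⟩
  · have h0 : (0 : Fin 3) ∉ ({u, v, w} : Set (Fin 3)) \ {2} := by simp [h]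
    simp only [Set.mem_sdiff, Set.mem_insert_iff, Set.mem_singleton_iff] at h0
    exact GHTypes.isFsigma_typeSet (by grind) (by grind) (by grind)
  · have h1 : (1 : Fin 3) ∉ ({u, v, w} : Set (Fin 3)) \ {2} := by simp [h]
    simp only [Set.mem_sdiff, Set.mem_insert_iff, Set.mem_singleton_iff] at h1
    exact GHTypes.isGδ_typeSet (by grind) (by grind) (by grind)
  · obtain ⟨s, t, hs, ht, heq⟩ := GHTypes.exists_typeSet_eq_inter u v w
    rw [heq]
    exact ⟨hs.inter_isGδ_isFsigmadelta ht, hs.inter_isGδ_isGdeltasigma ht⟩
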